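/- **Definitions.** Positions in a word start at $0$. For integers $0\le\alpha\le n$ with $\gcd(n,\alpha)=1$, the Christoffel word $C(n,\alpha)$ over an ordered alphabet $\{s<t\}$ is the word $u[0]u[1]\cdots u[n-1]$ with $u[i]=s$ if $((i+1)\beta \bmod n) > (i\beta \bmod n)$ and $u[i]=t$ otherwise, where $\beta=n-\alpha$; in the degenerate case $\beta=0$ (so $n=\alpha=1$), it is the one-letter word $s$. The reversal of a finite word $w$ is denoted by $\widetilde w$, and $\gamma$ is the conjugacy operator on finite words, which moves the first letter to the end; it is a bijection, and so $\gamma^k$ is defined for all $k\in\mathbb Z$. Let $u\in\{a,x\}^n$ and $v\in\{b,x\}^m$ be words, let $A$ be the set of positions of the letter $a$ in $u$ and $B$ the set of positions of the letter $b$ in $v$. Then $u$ and $v$ are superimposable if there is $k\in\mathbb Z$ with $(A+n\mathbb Z)\cap(B-k+m\mathbb Z)=\emptyset$, and perfectly superimposable if this holds for $k=0$. **Theorem 4.4.** Let $q,\alpha,\beta,n,m$ be nonnegative integers with $\gcd(\alpha,\beta)=1$, $q\alpha\le n$, $q\beta\le m$, $\gcd(n,q\alpha)=1$ and $\gcd(m,q\beta)=1$,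 let $C(n,q\alpha)$ be the Christoffel word over $\{a<x\}$ and $C(m,q\beta)$ the Christoffel word over $\{b<x\}$, and let $p=\gcd(m,n)$. Suppose that $C(n,q\alpha)$ and $C(m,q\beta)$ are superimposable. Then, for every integer $r$ with $qr\equiv 1 \pmod p$ and every integer $i$ with $0\le i<\frac mp$, the words $C(n,q\alpha)$ and $\gamma^{-(r-1)+ip}\,\widetilde{C}(m,q\beta)$ are perfectly superimposable. -/

import Mathlib

namespace Christoffel

/-- The three letters: `a` and `x` for the first word, `b` and `x` for the second one. -/
inductive Letter where
  | a
  | b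
  | x

/-- The word `C(n, α)` over the ordered alphabet `{s < t}`: its `i`-th letter is `s` if
`(i + 1) β mod n > i β mod n`, where `β = n - α`, and `t` otherwise. It is meant for `α ≤ n`, and
it is the Christoffel word of slope `β / α` when `α` and `n` are coprime. In the degenerate case
`β = 0` there is no `t`, and every letter is `s`, so that the word has `α` letters `s` in
all cases. -/
def word {A : Type*} (s t : A) (n α : ℕ) : List A :=
  (List.range n).map fun i =>
    if n - α = 0 ∨ i * (n - α) % n < (i + 1) * (n - α) % n then s else t

/-- The conjugacy operator `γ`, which moves the first letter of a word to its end, as a permutation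
of the set of finite words; `γ ^ k` is thus defined for every `k : ℤ`. -/
def gamma {A : Type*} : Equiv.Perm (List A) where
  toFun w := w.rotate 1
  invFun w := w.rotate (w.length - 1)
  left_inv w := by
    cases w with
    | nil => rfl
    | cons c l =>
      change ((c :: l).rotate 1).rotate (((c :: l).rotate 1).length - 1) = c :: l
      rw [List.rotate_rotate, List.length_rotate]
      have h : 1 + ((c :: l).length - 1) = (c :: l).length := by
        simp only [List.length_cons]; omega
      rw [h, List.rotate_length]
  right_inv w := by
    cases w with
    | nil => rfl
    | cons c l =>
      change ((c :: l).rotate ((c :: l).length - 1)).rotate 1 = c :: l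
      rw [List.rotate_rotate]
      have h : (c :: l).length - 1 + 1 = (c :: l).length := by
        simp only [List.length_cons]; omega
      rw [h, List.rotate_length]

/-- The set of positions of the letter `c` in the finite word `u` (positions start at `0`). -/
def positions {A : Type*} (c : A) (u : List A) : Set ℤ :=
  {z | ∃ j : ℕ, u[j]? = some c ∧ z = j}

/-- With `A` the set of positions of the letter `a` in `u` and `B` the set of positions of the
letter `b` in `v`: the sets `A + |u| ℤ` and `B - k + |v| ℤ` are disjoint. -/
def DisjointWithShift (u v : List Letter) (k : ℤ) : Prop :=
  Disjoint {z : ℤ | ∃ i ∈ positions Letter.a u, ∃ t : ℤ, z = i + u.length * t}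
    {z : ℤ | ∃ j ∈ positions Letter.b v, ∃ t : ℤ, z = j - k + v.length * t}

/-- `u` and `v` are superimposable: some shift of the second word works. -/
def Superimposable (u v : List Letter) : Prop :=
  ∃ k : ℤ, DisjointWithShift u v k

/-- `u` and `v` are perfectly superimposable: the shift `0` works. -/
def PerfectlySuperimposable (u v : List Letter) : Prop :=
  DisjointWithShift u v 0

end Christoffel

namespace Christoffel

/-! ### The numerical semigroup generated by two coprime integers -/

/-! Let S be the semigroup generated by α and β, F = αβ - α - β and p = gcd(m, n); if qαβ = 0, some
letter is absent and nothing can collide. The letter `a` sits at the z with (-z·qα mod n) < qα, and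
similarly for `b`. By the Chinese remainder theorem, a shift produces a collision exactly when a
residue mod p determined by the shift is attained by some βj + αl in the box 0 ≤ j < qα, 0 ≤ l < qβ.
Box values are the e with both e and 2qαβ - α - β - e in S (`exists_mem_box`, `isComb_of_box`). For
the shifts of the theorem the residue is, after reflecting the box, that of F. If it is attained,
the symmetry of S about F gives (2q-1)αβ - p ∈ S (`isComb_sub_of_frobenius_modEq`). Then every
residue is attained (`exists_modEq_mem_box`), so no shift at all avoids collisions. -/

/-- `z` is a combination of `a` and `b` with nonnegative integer coefficients. -/
def IsComb (a b z : ℤ) : Prop := ∃ x y : ℤ, 0 ≤ x ∧ 0 ≤ y ∧ z = a * x + b * y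

theorem IsComb.add {a b z w : ℤ} (hz : IsComb a b z) (hw : IsComb a b w) :
    IsComb a b (z + w) := by
  obtain ⟨x, y, hx, hy, rfl⟩ := hz
  obtain ⟨x', y', hx', hy', rfl⟩ := hw
  exact ⟨x + x', y + y', by omega, by omega, by ring⟩

theorem IsComb.mul {a b z k : ℤ} (hz : IsComb a b z) (hk : 0 ≤ k) : IsComb a b (k * z) := by
  obtain ⟨x, y, hx, hy, rfl⟩ := hz
  exact ⟨k * x, k * y, by positivity, by positivity, by ring⟩

theorem exists_reduced {a b : ℤ} (ha : 0 < a) (hab : IsCoprime a b) (z : ℤ) :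
    ∃ x y : ℤ, 0 ≤ y ∧ y < a ∧ z = a * x + b * y := by
  obtain ⟨u, v, huv⟩ := hab
  refine ⟨z * u + b * (z * v / a), z * v % a, Int.emod_nonneg _ ha.ne', Int.emod_lt_of_pos _ ha, ?_⟩
  have h := Int.emod_add_mul_ediv (z * v) a
  linear_combination (-z) * huv - b * h

/-- Representations of one integer differ by multiples of (b, -a). As y < a, passing to one with
second coefficient ≥ 0 cannot increase the first. -/
theorem IsComb.nonneg_of_reduced {a b x y : ℤ} (ha : 0 < a) (hb : 0 < b) (hab : IsCoprime a b)
    (hy : y < a) (h : IsComb a b (a * x + b * y)) : 0 ≤ x := by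
  obtain ⟨x', y', hx', hy', h⟩ := h
  have hd : a ∣ y' - y := hab.dvd_of_dvd_mul_left ⟨x - x', by linear_combination -h⟩
  obtain ⟨k, hk⟩ := hd
  have hk0 : 0 ≤ k := by
    by_contra hneg
    have : a * k ≤ a * (-1) := by gcongr; omega
    linarith
  have hx : x = x' + b * k := by
    apply mul_left_cancel₀ ha.ne'
    linear_combination h + b * hk
  rw [hx]; positivity

theorem isComb_or_frobenius_sub {a b : ℤ} (ha : 0 < a) (hab : IsCoprime a b) (z : ℤ) :
    IsComb a b z ∨ IsComb a b (a * b - a - b - z) := by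
  obtain ⟨x, y, hy, hya, rfl⟩ := exists_reduced ha hab z
  rcases le_or_gt 0 x with hx | hx
  · exact Or.inl ⟨x, y, hx, hy, rfl⟩
  · exact Or.inr ⟨-1 - x, a - 1 - y, by omega, by omega, by ring⟩

theorem not_isComb_frobenius {a b : ℤ} (ha : 0 < a) (hb : 0 < b) (hab : IsCoprime a b) :
    ¬ IsComb a b (a * b - a - b) := by
  intro h
  have h' : IsComb a b (a * (-1) + b * (a - 1)) := by convert h using 1; ring
  have := h'.nonneg_of_reduced ha hb hab (by omega)
  omega

/-- In the reduced form a * l + b * j with 0 ≤ j < a, the hypotheses say 0 ≤ l < (2q-1)b. Trading b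
copies of a for a copies of b, at most q-1 times, brings both coefficients into the box. -/
theorem exists_mem_box {a b q e : ℤ} (ha : 0 < a) (hb : 0 < b) (hq : 0 < q)
    (hab : IsCoprime a b) (he : IsComb a b e) (he' : IsComb a b (2 * q * a * b - a - b - e)) :
    ∃ j l : ℤ, 0 ≤ j ∧ j < q * a ∧ 0 ≤ l ∧ l < q * b ∧ e = b * j + a * l := by
  obtain ⟨l, j, hj, hja, rfl⟩ := exists_reduced ha hab e
  have hl : 0 ≤ l := he.nonneg_of_reduced ha hb hab hja
  have hl' : 0 ≤ (2 * q - 1) * b - 1 - l := by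
    refine IsComb.nonneg_of_reduced (y := a - 1 - j) ha hb hab (by omega) ?_
    convert he' using 1; ring
  have hd := Int.emod_add_mul_ediv l b
  have hm0 := Int.emod_nonneg l hb.ne'
  have hmb := Int.emod_lt_of_pos l hb
  have ht0 : 0 ≤ l / b := Int.ediv_nonneg hl hb.le
  rcases le_or_gt (l / b) (q - 1) with ht | ht
  · refine ⟨j + a * (l / b), l % b, by positivity, ?_, hm0, by nlinarith, ?_⟩
    · nlinarith
    · linear_combination -a * hd
  · refine ⟨j + a * (q - 1), l - b * (q - 1), ?_, by nlinarith, by nlinarith, by nlinarith, by ring⟩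
    have : 0 ≤ q - 1 := by omega
    positivity

theorem isComb_of_box {a b q j l : ℤ} (hj : 0 ≤ j) (hja : j < q * a) (hl : 0 ≤ l)
    (hlb : l < q * b) :
    IsComb a b (b * j + a * l) ∧ IsComb a b (2 * q * a * b - a - b - (b * j + a * l)) :=
  ⟨⟨l, j, hl, hj, by ring⟩, ⟨q * b - 1 - l, q * a - 1 - j, by omega, by omega, by ring⟩⟩

/-- If p ∈ S, then t ≤ 0 would put F = e - pt in S, and for t ≥ 1 adding (t-1)p to the complement of
e gives the claim. Otherwise F - p ∈ S, and the rest is visibly a combination. -/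
theorem isComb_sub_of_frobenius_modEq {a b q p e t : ℤ} (ha : 0 < a) (hb : 0 < b) (hq : 0 < q)
    (hab : IsCoprime a b) (he : IsComb a b e) (he' : IsComb a b (2 * q * a * b - a - b - e))
    (het : e = a * b - a - b + p * t) : IsComb a b ((2 * q - 1) * a * b - p) := by
  have hF := not_isComb_frobenius ha hb hab
  rcases isComb_or_frobenius_sub ha hab p with hS | hS
  · rcases le_or_gt t 0 with ht | ht
    · refine absurd (he.add (hS.mul (k := -t) (by omega))) ?_
      convert hF using 2
      rw [het]; ring
    · convert he'.add (hS.mul (k := t - 1) (by omega)) using 1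
      rw [het]; ring
  · have h1 : IsComb a b ((2 * q - 2) * a * b + a + b) :=
      ⟨(2 * q - 2) * b + 1, 1, by have : 0 ≤ 2 * q - 2 := by omega
                                  positivity, by omega, by ring⟩
    convert h1.add hS using 1; ring

theorem exists_modEq_mem_box {a b q p : ℤ} (ha : 0 < a) (hb : 0 < b) (hq : 0 < q) (hp : 0 < p)
    (hab : IsCoprime a b) (h : IsComb a b ((2 * q - 1) * a * b - p)) (z : ℤ) :
    ∃ j l t : ℤ, 0 ≤ j ∧ j < q * a ∧ 0 ≤ l ∧ l < q * b ∧ b * j + a * l = z + p * t := by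
  have hnonneg : ∀ w, IsComb a b w → 0 ≤ w := by
    rintro w ⟨x, y, hx, hy, rfl⟩; positivity
  -- With z + pt the last term outside S, the next term e is in S, and its complement is (F - (z +
  -- pt)) + ((2q-1)ab - p), a sum of two elements of S.
  obtain ⟨t, ht, hmax⟩ : ∃ t, ¬ IsComb a b (z + p * t) ∧
      ∀ s, ¬ IsComb a b (z + p * s) → s ≤ t := by
    apply Int.exists_greatest_of_bdd (P := fun t => ¬ IsComb a b (z + p * t))
    · refine ⟨|a * b - a - b - z|, fun s hs => ?_⟩
      have h1 := hnonneg _ ((isComb_or_frobenius_sub ha hab _).resolve_left hs)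
      have h2 := le_abs_self (a * b - a - b - z)
      have h3 := abs_nonneg (a * b - a - b - z)
      by_contra hlt
      nlinarith
    · refine ⟨-|z| - 1, fun hs => ?_⟩
      have h1 := hnonneg _ hs
      have h2 := le_abs_self z
      have h3 := abs_nonneg z
      nlinarith
  have he : IsComb a b (z + p * (t + 1)) := by
    by_contra hne
    have := hmax _ hne
    omega
  have he' : IsComb a b (2 * q * a * b - a - b - (z + p * (t + 1))) := by
    convert ((isComb_or_frobenius_sub ha hab _).resolve_left ht).add h using 1; ring
  obtain ⟨j, l, hj, hja, hl, hlb, hjl⟩ := exists_mem_box ha hb hq hab he he'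
  exact ⟨j, l, t + 1, hj, hja, hl, hlb, hjl.symm⟩

/-! ### Periodic sets of positions -/

/-- The positions of the letter `c` in the biinfinite periodic word with period `w`. -/
def periodicPositions {A : Type*} (c : A) (w : List A) : Set ℤ :=
  {z | ∃ i ∈ positions c w, ∃ t : ℤ, z = i + w.length * t}

theorem mem_periodicPositions {A : Type*} {c : A} {w : List A} (i : ℕ) (t : ℤ) {z : ℤ}
    (hi : i < w.length) (hz : z = i + w.length * t) :
    z ∈ periodicPositions c w ↔ w[i]? = some c := by
  constructor
  · rintro ⟨_, ⟨j, hj, rfl⟩, s, hs⟩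
    have hjl : j < w.length := by
      by_contra hlt
      rw [List.getElem?_eq_none (by omega)] at hj
      simp at hj
    have h1 : z % w.length = i := by
      rw [hz, Int.add_mul_emod_self_left]; exact Int.emod_eq_of_lt (by omega) (by omega)
    have h2 : z % w.length = j := by
      rw [hs, Int.add_mul_emod_self_left]; exact Int.emod_eq_of_lt (by omega) (by omega)
    have : i = j := by omega
    rwa [this]
  · intro h
    exact ⟨i, ⟨i, h, rfl⟩, t, hz⟩

theorem exists_rep {n : ℕ} (hn : 0 < n) (z : ℤ) : ∃ (i : ℕ) (t : ℤ), i < n ∧ z = i + n * t := by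
  have h0 := Int.emod_nonneg z (b := n) (by omega)
  have h1 := Int.emod_lt_of_pos z (b := n) (by omega)
  refine ⟨(z % n).toNat, z / n, by omega, ?_⟩
  rw [Int.toNat_of_nonneg h0, Int.emod_add_mul_ediv]

theorem periodicPositions_nil {A : Type*} (c : A) (z : ℤ) :
    z ∉ periodicPositions c ([] : List A) := by
  rintro ⟨_, ⟨j, hj, rfl⟩, _⟩
  simp at hj

theorem length_gamma {A : Type*} (w : List A) : (gamma w).length = w.length :=
  List.length_rotate ..

theorem length_gamma_zpow {A : Type*} (k : ℤ) (w : List A) :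
    ((gamma ^ k) w).length = w.length := by
  induction k with
  | zero => rfl
  | succ k ih => rw [add_comm, zpow_add, Equiv.Perm.mul_apply, zpow_one, length_gamma, ih]
  | pred k ih =>
    rw [← ih, ← length_gamma, ← Equiv.Perm.mul_apply, ← zpow_one_add]
    congr 3; ring

theorem mem_periodicPositions_gamma {A : Type*} {c : A} (w : List A) (z : ℤ) :
    z ∈ periodicPositions c (gamma w) ↔ z + 1 ∈ periodicPositions c w := by
  rcases Nat.eq_zero_or_pos w.length with h0 | hpos
  · rw [List.length_eq_zero_iff] at h0
    subst h0
    exact iff_of_false (periodicPositions_nil c z) (periodicPositions_nil c _)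
  · obtain ⟨i, t, hi, hz⟩ := exists_rep hpos z
    have hlen := length_gamma w
    have hm : (i + 1) % w.length < w.length := Nat.mod_lt _ hpos
    rw [mem_periodicPositions i t (by rwa [hlen]) (by rwa [hlen]),
      mem_periodicPositions ((i + 1) % w.length) (t + ((i + 1) / w.length : ℕ)) hm]
    · rw [show gamma w = w.rotate 1 from rfl, List.getElem?_rotate hi]
    · have := Nat.mod_add_div (i + 1) w.length
      zify at this
      push_cast
      linear_combination hz - this

theorem mem_periodicPositions_gamma_zpow {A : Type*} {c : A} (k : ℤ) (w : List A) (z : ℤ) :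
    z ∈ periodicPositions c ((gamma ^ k) w) ↔ z + k ∈ periodicPositions c w := by
  induction k generalizing z with
  | zero => simp
  | succ k ih =>
    rw [add_comm, zpow_add, Equiv.Perm.mul_apply, zpow_one, mem_periodicPositions_gamma, ih,
      add_assoc]
  | pred k ih =>
    have h : gamma ((gamma ^ (-(k : ℤ) - 1)) w) = (gamma ^ (-(k : ℤ))) w := by
      rw [← Equiv.Perm.mul_apply, ← zpow_one_add]
      congr 2; ring
    have h' := ih (z - 1)
    rw [← h, mem_periodicPositions_gamma, sub_add_cancel] at h'
    rw [h']
    ring_nf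

theorem mem_periodicPositions_reverse {A : Type*} {c : A} (w : List A) (z : ℤ) :
    z ∈ periodicPositions c w.reverse ↔ -1 - z ∈ periodicPositions c w := by
  rcases Nat.eq_zero_or_pos w.length with h0 | hpos
  · rw [List.length_eq_zero_iff] at h0
    subst h0
    exact iff_of_false (periodicPositions_nil c z) (periodicPositions_nil c _)
  · obtain ⟨i, t, hi, hz⟩ := exists_rep hpos z
    have hlen := List.length_reverse (as := w)
    rw [mem_periodicPositions i t (by rwa [hlen]) (by rwa [hlen]),
      mem_periodicPositions (w.length - 1 - i) (-1 - t) (by omega),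
      List.getElem?_reverse hi]
    rw [Nat.sub_sub, Nat.cast_sub (by omega)]
    push_cast
    linear_combination -hz

theorem length_word {A : Type*} (s t : A) (n a : ℕ) : (word s t n a).length = n := by
  simp [word]

theorem disjointWithShift_iff (u v : List Letter) (k : ℤ) :
    DisjointWithShift u v k ↔ ∀ z, z ∈ periodicPositions Letter.a u →
      z + k ∉ periodicPositions Letter.b v := by
  rw [DisjointWithShift, Set.disjoint_left]
  refine forall_congr' fun z => imp_congr Iff.rfl (not_congr ?_)
  refine exists_congr fun j => and_congr Iff.rfl (exists_congr fun t => ?_)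
  constructor <;> intro h <;> linear_combination h

/-! ### Positions in Christoffel words -/

/-- Modulo n, i(n-a) ≡ -ia, and adding n-a to a residue c wraps around exactly when c ≥ a. -/
theorem letter_condition_iff {n a : ℕ} (hn : 0 < n) (ha : a ≤ n) (hna : n.Coprime a) (i : ℕ) :
    (n - a = 0 ∨ i * (n - a) % n < (i + 1) * (n - a) % n) ↔ (-(i : ℤ) * a) % n < a := by
  have hmod : (-(i : ℤ) * a) % n = ((i * (n - a) % n : ℕ) : ℤ) := by
    push_cast [Nat.cast_sub ha]
    rw [show (i : ℤ) * (n - a) = -i * a + n * i by ring, Int.add_mul_emod_self_left]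
  rw [hmod, Nat.cast_lt]
  have hlt := Nat.mod_lt (i * (n - a)) hn
  rcases Nat.eq_zero_or_pos (n - a) with h0 | hpos
  · have : a = n := by omega
    subst this
    simp [hn]
  · rw [Nat.add_mul, one_mul, Nat.add_mod]
    have ha0 : a = 0 → n = 1 := by
      rintro rfl; simpa using hna
    rcases Nat.eq_zero_or_pos a with rfl | ha'
    · have := ha0 rfl
      subst this
      simp [Nat.mod_one]
    · rw [Nat.mod_eq_of_lt (show n - a < n by omega)]
      generalize i * (n - a) % n = c at hlt ⊢
      rcases Nat.lt_or_ge c a with h | h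
      · rw [Nat.mod_eq_of_lt (show c + (n - a) < n by omega)]
        omega
      · rw [Nat.mod_eq_sub_mod (show n ≤ c + (n - a) by omega),
          Nat.mod_eq_of_lt (show c + (n - a) - n < n by omega)]
        omega

theorem mem_periodicPositions_word {A : Type*} {s t : A} (hst : t ≠ s) {n a : ℕ} (hn : 0 < n)
    (ha : a ≤ n) (hna : n.Coprime a) (z : ℤ) :
    z ∈ periodicPositions s (word s t n a) ↔ (-z * a) % n < a := by
  obtain ⟨i, k, hi, hz⟩ := exists_rep hn z
  rw [mem_periodicPositions i k (by rwa [length_word]) (by rwa [length_word]), hz,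
    show -((i : ℤ) + n * k) * a = -i * a + n * (-k * a) by ring, Int.add_mul_emod_self_left,
    ← letter_condition_iff hn ha hna i]
  simp only [word, List.getElem?_map, List.getElem?_range hi, Option.map_some, Option.some.injEq]
  split_ifs with h
  · simp [h]
  · simp [h, hst]

theorem exists_modEq_mul {n a : ℤ} (h : IsCoprime n a) (j : ℤ) : ∃ x t : ℤ, x * a = j + n * t := by
  obtain ⟨u, v, huv⟩ := h
  exact ⟨j * v, -j * u, by linear_combination j * huv⟩

/-- If every residue modulo `gcd m n` is hit by the box, then no shift separates the words. -/
theorem not_superimposable_of_forall_residue {n m q a b : ℕ} (hn : q * a ≤ n) (hn0 : 0 < n)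
    (hna : n.Coprime (q * a)) (hm : q * b ≤ m) (hm0 : 0 < m) (hmb : m.Coprime (q * b))
    (h : ∀ z : ℤ, ∃ j l t : ℤ, 0 ≤ j ∧ j < q * a ∧ 0 ≤ l ∧ l < q * b ∧
      b * j + a * l = z + (m.gcd n : ℤ) * t) :
    ¬ Superimposable (word Letter.a Letter.x n (q * a)) (word Letter.b Letter.x m (q * b)) := by
  rintro ⟨k, hk⟩
  rw [disjointWithShift_iff] at hk
  -- The residue of `b` is taken to be qb-1-l, which turns the difference of the two congruences
  -- into a sum and yields this target.
  obtain ⟨j, l, t, hj, hja, hl, hlb, hjl⟩ := h (a * (q * b - 1) + q * a * b * k)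
  have hgm : (m.gcd n : ℤ) ∣ m := by exact_mod_cast Nat.gcd_dvd_left m n
  have hgn : (m.gcd n : ℤ) ∣ n := by exact_mod_cast Nat.gcd_dvd_right m n
  have cna : IsCoprime (n : ℤ) (q * a) := by exact_mod_cast Nat.isCoprime_iff_coprime.2 hna
  have cmb : IsCoprime (m : ℤ) (q * b) := by exact_mod_cast Nat.isCoprime_iff_coprime.2 hmb
  obtain ⟨x, s, hx⟩ := exists_modEq_mul cna (-j)
  obtain ⟨y, s', hy⟩ := exists_modEq_mul cmb (-(q * b - 1 - l))
  have hdvd : (m.gcd n : ℤ) ∣ (x + k - y) * ((q * a) * b) := by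
    obtain ⟨m', hm'⟩ := hgm
    obtain ⟨n', hn'⟩ := hgn
    refine ⟨n' * s * b - m' * s' * a - t, ?_⟩
    linear_combination b * hx - a * hy - hjl + s * b * hn' - s' * a * hm'
  have hcop : IsCoprime (m.gcd n : ℤ) ((q * a) * b) :=
    (cna.of_isCoprime_of_dvd_left hgn).mul_right
      ((cmb.of_isCoprime_of_dvd_left hgm).of_mul_right_right)
  obtain ⟨c, hc⟩ := hcop.dvd_of_dvd_mul_right hdvd
  have hbez := Nat.gcd_eq_gcd_ab m n
  -- Since x + k - y = c * gcd, Bézout moves x by a multiple of n so that its shift by k lands in y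
  -- + mℤ.
  have h1 : x - n * (m.gcdB n * c) ∈ periodicPositions Letter.a
      (word Letter.a Letter.x n (q * a)) := by
    rw [mem_periodicPositions_word (by simp) hn0 hn hna]
    push_cast
    rw [show -(x - (n : ℤ) * (m.gcdB n * c)) * (q * a) = j + n * (m.gcdB n * c * (q * a) - s) by
      linear_combination -hx, Int.add_mul_emod_self_left]
    rwa [Int.emod_eq_of_lt hj (by push_cast [← Nat.cast_le (α := ℤ)] at hn; linarith)]
  refine hk _ h1 ?_
  rw [mem_periodicPositions_word (by simp) hm0 hm hmb]
  push_cast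
  rw [show -(x - (n : ℤ) * (m.gcdB n * c) + k) * (q * b) =
      (q * b - 1 - l) + m * (-(m.gcdA n * c * (q * b)) - s') by
    linear_combination -hy - (q * b) * hc - (q * b) * c * hbez, Int.add_mul_emod_self_left,
    Int.emod_eq_of_lt (by linarith) (by push_cast [← Nat.cast_le (α := ℤ)] at hm; linarith)]
  linarith

end Christoffel

open Christoffel in
theorem theorem4p4 (n m q α β : ℕ)
    -- `C(n, qα)` and `C(m, qβ)` are Christoffel words
    (hn : q * α ≤ n) (hnα : Nat.Coprime n (q * α))
    (hm : q * β ≤ m) (hmβ : Nat.Coprime m (q * β))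
    (hαβ : Nat.Coprime α β)
    (hsup : Christoffel.Superimposable
      (Christoffel.word Christoffel.Letter.a Christoffel.Letter.x n (q * α))
      (Christoffel.word Christoffel.Letter.b Christoffel.Letter.x m (q * β)))
    (r : ℤ) (hr : (q : ℤ) * r ≡ 1 [ZMOD (Nat.gcd m n : ℤ)])
    (i : ℕ) (hi : i < m / Nat.gcd m n) :
    Christoffel.PerfectlySuperimposable
      (Christoffel.word Christoffel.Letter.a Christoffel.Letter.x n (q * α))
      ((Christoffel.gamma ^ (-(r - 1) + (i : ℤ) * (Nat.gcd m n : ℤ)))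
        (Christoffel.word Christoffel.Letter.b Christoffel.Letter.x m (q * β)).reverse) := by
  have hn0 : 0 < n := by
    rcases Nat.eq_zero_or_pos n with rfl | h
    · rw [Nat.coprime_zero_left] at hnα; omega
    · exact h
  have hm0 : 0 < m := by
    rcases Nat.eq_zero_or_pos m with rfl | h
    · rw [Nat.coprime_zero_left] at hmβ; omega
    · exact h
  rw [PerfectlySuperimposable, disjointWithShift_iff]
  intro z hz hz'
  rw [add_zero, mem_periodicPositions_gamma_zpow, mem_periodicPositions_reverse,
    mem_periodicPositions_word (by simp) hm0 hm hmβ] at hz'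
  rw [mem_periodicPositions_word (by simp) hn0 hn hnα] at hz
  have hj := Int.emod_nonneg (-z * ((q * α : ℕ) : ℤ)) (b := n) (by omega)
  have hl := Int.emod_nonneg (-(-1 - (z + (-(r - 1) + (i : ℤ) * (m.gcd n : ℤ)))) *
    ((q * β : ℕ) : ℤ)) (b := m) (by omega)
  have hjd := Int.emod_add_mul_ediv (-z * ((q * α : ℕ) : ℤ)) n
  have hld := Int.emod_add_mul_ediv (-(-1 - (z + (-(r - 1) + (i : ℤ) * (m.gcd n : ℤ)))) *
    ((q * β : ℕ) : ℤ)) m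
  set j := (-z * ((q * α : ℕ) : ℤ)) % n
  set l := (-(-1 - (z + (-(r - 1) + (i : ℤ) * (m.gcd n : ℤ)))) * ((q * β : ℕ) : ℤ)) % m
  set A := (-z * ((q * α : ℕ) : ℤ)) / n
  set B := (-(-1 - (z + (-(r - 1) + (i : ℤ) * (m.gcd n : ℤ)))) * ((q * β : ℕ) : ℤ)) / m
  push_cast at hz hz' hjd hld
  have hqα : 0 < q * α := by zify; linarith
  have hqβ : 0 < q * β := by zify; linarith
  have hq : (0 : ℤ) < q := by exact_mod_cast Nat.pos_of_mul_pos_right hqα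
  have hα : (0 : ℤ) < α := by exact_mod_cast Nat.pos_of_mul_pos_left hqα
  have hβ : (0 : ℤ) < β := by exact_mod_cast Nat.pos_of_mul_pos_left hqβ
  have hab : IsCoprime (α : ℤ) β := Nat.isCoprime_iff_coprime.2 hαβ
  have hp : (0 : ℤ) < m.gcd n := by exact_mod_cast Nat.gcd_pos_of_pos_left n hm0
  obtain ⟨m', hm'⟩ : (m.gcd n : ℤ) ∣ m := by exact_mod_cast Nat.gcd_dvd_left m n
  obtain ⟨n', hn'⟩ : (m.gcd n : ℤ) ∣ n := by exact_mod_cast Nat.gcd_dvd_right m n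
  obtain ⟨c, hc⟩ := hr.dvd
  obtain ⟨he, he'⟩ := isComb_of_box hj hz hl hz'
  -- The collision has βj + αl ≡ (2q-1)αβ mod p, because qr ≡ 1; its reflection in the box, supplied
  -- by `he'`, is therefore ≡ F.
  refine not_superimposable_of_forall_residue hn hn0 hnα hm hm0 hmβ
    (exists_modEq_mem_box hα hβ hq hp hab ?_) hsup
  refine isComb_sub_of_frobenius_modEq hα hβ hq hab he' (by rwa [sub_sub_cancel])
    (t := β * n' * A + α * m' * B - i * q * α * β - c * α * β) ?_
  linear_combination -β * hjd - α * hld - α * β * hc + β * A * hn' + α * B * hm'
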